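/- Let $K,N$ be natural numbers ($K$ receivers, $N$ transmit antennas). For $i=1,\dots,K$ let $\bar h_i\in\mathbb C^N$ and let $\gamma_i>0$, $\sigma_i^2>0$, $r_i>0$ be real. Write $\mathbb H^n$ for the $n\times n$ complex Hermitian matrices, $\succeq 0$ for positive semidefinite, $[I\ \ \bar h_i]$ for the $N\times(N+1)$ block matrix, and, for $W=(W_1,\dots,W_K)$ with $W_i\in\mathbb H^N$, $$M_i(W)=\tfrac1{\gamma_i}W_i-\sum_{k\ne i}W_k .$$ Robust SDR problem. Minimize $\sum_{i=1}^K\operatorname{tr}(W_i)$ over $W_i\in\mathbb H^N$, $\lambda_i\in\mathbb R$ ($i=1,\dots,K$) subject to $W_i\succeq0$, $\lambda_i\ge0$ and $$\Psi_i(W,\lambda_i)=\begin{bmatrix}I\\ \bar h_i^H\end{bmatrix}M_i(W)\begin{bmatrix}I&\bar h_i\end{bmatrix}+\begin{bmatrix}\lambda_iI&0\\0&-\sigma_i^2-\lambda_ir_i^2\end{bmatrix}\succeq0,\qquad i=1,\dots,K.$$ Max-min SDR problem. Maximize, over $V=(V_1,\dots,V_K)$ with $V_i\in\mathbb H^{N+1}$,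 $V_i\succeq0$, $\operatorname{tr}(V_i)\le1+r_i^2$ and $(N+1,N+1)$ entry $[V_i]_{N+1}=1$ for all $i$, the optimal value of the following inner problem: minimize $\sum_{i=1}^K\operatorname{tr}(W_i)$ over $W_i\in\mathbb H^N$ subject to $W_i\succeq0$ and $$\operatorname{tr}\bigl(M_i(W)R_i\bigr)\ge\sigma_i^2,\qquad R_i=[I\ \ \bar h_i]\,V_i\,[I\ \ \bar h_i]^H,\qquad i=1,\dots,K$$ (the inner value is the infimum, $+\infty$ if the inner problem is infeasible). Suppose that the robust SDR problem is feasible. Then the robust SDR problem and the max-min SDR problem attain the same (finite) optimal value: there is a real $p$ that is both the minimum of the former and the maximum of the latter. Moreover, if $(W_1^\star,\dots,W_K^\star,\lambda_1^\star,\dots,\lambda_K^\star)$ is an optimal solution of the robust SDR problem, then there is $V^\star=(V_1^\star,\dots,V_K^\star)$ such that $(V^\star,W^\star)$ is an optimal outer-inner solution pair of the max-min SDR problem, i.e. $V^\star$ is feasible for and attains the outer maximum, and $W^\star$ is an optimal solution of the inner minimization for $V=V^\star$. -/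

import Mathlib

open scoped Matrix ComplexOrder

/-- The data of a downlink with `K` receivers and `N` transmit antennas: channel estimates `hbar i`,
SINR targets `γ i`, noise levels `σ i` (noise power `σ i ^ 2`) and uncertainty radii `r i`. -/
structure Downlink (K N : ℕ) where
  /-- channel estimate of each receiver -/
  hbar : Fin K → Fin N → ℂ
  /-- SINR requirement of each receiver -/
  γ : Fin K → ℝ
  /-- noise standard deviation at each receiver -/
  σ : Fin K → ℝ
  /-- radius of the uncertainty ball of each receiver -/
  r : Fin K → ℝ

namespace Downlink

variable {K N : ℕ}

/-- The total transmit power `∑ i, tr (W i)`. The trace is real on Hermitian matrices. -/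
noncomputable def power (W : Fin K → Matrix (Fin N) (Fin N) ℂ) : ℝ :=
  ∑ i, (W i).trace.re

/-- The matrix `(1 / γ i) W i - ∑_{k ≠ i} W k`. -/
noncomputable def gap (D : Downlink K N) (W : Fin K → Matrix (Fin N) (Fin N) ℂ) (i : Fin K) :
    Matrix (Fin N) (Fin N) ℂ :=
  ((1 / D.γ i : ℝ) : ℂ) • W i - ∑ k ∈ Finset.univ.erase i, W k

/-- The `N × (N + 1)` block matrix `[I  hbar i]`; the last coordinate is `Sum.inr ()`. -/
def aug (D : Downlink K N) (i : Fin K) : Matrix (Fin N) (Fin N ⊕ Unit) ℂ :=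
  Matrix.fromCols 1 (Matrix.replicateCol Unit (D.hbar i))

/-- The matrix function `Ψ i (W, l)` of the robust semidefinite program. -/
noncomputable def Psi (D : Downlink K N) (W : Fin K → Matrix (Fin N) (Fin N) ℂ) (l : ℝ)
    (i : Fin K) : Matrix (Fin N ⊕ Unit) (Fin N ⊕ Unit) ℂ :=
  (D.aug i)ᴴ * D.gap W i * D.aug i +
    Matrix.fromBlocks ((l : ℂ) • 1) 0 0
      (((-(D.σ i) ^ 2 - l * (D.r i) ^ 2 : ℝ) : ℂ) • 1)

/-- The feasible set of the robust SDR semidefinite program, in the variables `(W, lam)`. -/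
def robustFeasible (D : Downlink K N) :
    Set ((Fin K → Matrix (Fin N) (Fin N) ℂ) × (Fin K → ℝ)) :=
  {x | (∀ i, (D.Psi x.1 (x.2 i) i).PosSemidef) ∧ (∀ i, (x.1 i).PosSemidef) ∧ ∀ i, 0 ≤ x.2 i}

/-- `(W, lam)` is an optimal solution of the robust SDR semidefinite program. -/
def IsRobustOptimal (D : Downlink K N) (W : Fin K → Matrix (Fin N) (Fin N) ℂ)
    (lam : Fin K → ℝ) : Prop :=
  (W, lam) ∈ D.robustFeasible ∧ ∀ x ∈ D.robustFeasible, power W ≤ power x.1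

/-- The feasible set of the outer maximization of the max-min SDR problem. -/
def outerFeasible (D : Downlink K N) :
    Set (Fin K → Matrix (Fin N ⊕ Unit) (Fin N ⊕ Unit) ℂ) :=
  {V | (∀ i, (V i).trace.re ≤ 1 + (D.r i) ^ 2) ∧ (∀ i, V i (Sum.inr ()) (Sum.inr ()) = 1) ∧
    ∀ i, (V i).PosSemidef}

/-- The matrix `R i = [I  hbar i] V i [I  hbar i]ᴴ`. -/
def R (D : Downlink K N) (V : Fin K → Matrix (Fin N ⊕ Unit) (Fin N ⊕ Unit) ℂ) (i : Fin K) :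
    Matrix (Fin N) (Fin N) ℂ :=
  D.aug i * V i * (D.aug i)ᴴ

/-- The feasible set of the inner minimization of the max-min SDR problem, for given `V`.
The trace below is real, as that of a product of two Hermitian matrices. -/
def innerFeasible (D : Downlink K N) (V : Fin K → Matrix (Fin N ⊕ Unit) (Fin N ⊕ Unit) ℂ) :
    Set (Fin K → Matrix (Fin N) (Fin N) ℂ) :=
  {W | (∀ i, (D.σ i) ^ 2 ≤ (D.gap W i * D.R V i).trace.re) ∧ ∀ i, (W i).PosSemidef}

/-- The optimal value of the inner minimization, for given `V` (`⊤` if it is infeasible). -/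
noncomputable def innerValue (D : Downlink K N)
    (V : Fin K → Matrix (Fin N ⊕ Unit) (Fin N ⊕ Unit) ℂ) : EReal :=
  ⨅ W ∈ D.innerFeasible V, (power W : EReal)

/-- `(V, W)` is an optimal outer-inner solution pair of the max-min SDR problem: `V` solves the
outer maximization, and `W` solves the inner minimization at this `V`. -/
def IsOuterInnerOptimal (D : Downlink K N)
    (V : Fin K → Matrix (Fin N ⊕ Unit) (Fin N ⊕ Unit) ℂ)
    (W : Fin K → Matrix (Fin N) (Fin N) ℂ) : Prop :=
  (V ∈ D.outerFeasible ∧ ∀ V' ∈ D.outerFeasible, D.innerValue V' ≤ D.innerValue V) ∧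
    (W ∈ D.innerFeasible V ∧ ∀ W' ∈ D.innerFeasible V, power W ≤ power W')

end Downlink

/-!
The robust problem is a semidefinite program whose Lagrangian dual, with multipliers `U i ⪰ 0` for
the constraints `Psi i ⪰ 0`, is the max-min problem up to normalization.

By cyclicity of the trace (`Downlink.trace_mul_Psi_re`), with `v i` the corner entry of `U i`,
`tr (U i * Psi i) = tr (gap i * R i) + lam i * (tr (U i) - (1 + r i ^ 2) * v i) - σ i ^ 2 * v i`.
If `v i = 1` and `tr (U i) ≤ 1 + r i ^ 2`, nonnegativity of the left side shows that every robust
feasible `W` is feasible for the inner problem at `U`; this is weak duality.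

For the converse, doubling a feasible point and raising `lam` slightly gives a Slater point
(`Downlink.posDef_Psi_two_smul`), so optimal multipliers exist
(`Matrix.exists_posSemidef_multipliers`, by separating convex sets). The Lagrangian is then at least
the robust optimum `p` on the whole cone `W ⪰ 0`, `lam ≥ 0`. Its homogeneous parts yield
`tr (U i) ≤ (1 + r i ^ 2) * v i`, `∑ i, tr (gap i * R i) ≤ ∑ i, tr (W i)`, and
`p ≤ ∑ i, σ i ^ 2 * v i`. Dividing each `U i` by `v i` (if `v i = 0`, then `U i = 0`) gives an outer
feasible `V` at which every inner feasible `W` has power at least `∑ i, v i * σ i ^ 2 ≥ p`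
(`Downlink.exists_outerFeasible_le_power`).

The robust minimum is attained by compactness (`Downlink.exists_isRobustOptimal`), and any robust
minimizer is inner feasible at this `V` with power `p`, hence inner optimal.
-/

/-! ### Positive semidefinite matrices and the trace form -/

namespace Matrix

variable {n : Type*} [Fintype n]

open scoped MatrixOrder in
lemma PosSemidef.exists_eq_conjTranspose_mul_self {A : Matrix n n ℂ} (hA : A.PosSemidef) :
    ∃ C : Matrix n n ℂ, A = Cᴴ * C := by
  classical
  exact CStarAlgebra.nonneg_iff_eq_star_mul_self.mp hA.nonneg

lemma PosSemidef.trace_mul_re_nonneg {A B : Matrix n n ℂ} (hA : A.PosSemidef)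
    (hB : B.PosSemidef) : 0 ≤ (A * B).trace.re := by
  classical
  obtain ⟨C, rfl⟩ := hA.exists_eq_conjTranspose_mul_self
  rw [Matrix.mul_assoc, trace_mul_comm]
  exact (Complex.le_def.mp (hB.mul_mul_conjTranspose_same C).trace_nonneg).1

lemma PosSemidef.norm_apply_le_trace {A : Matrix n n ℂ} (hA : A.PosSemidef) (a b : n) :
    ‖A a b‖ ≤ A.trace.re := by
  classical
  obtain ⟨C, rfl⟩ := hA.exists_eq_conjTranspose_mul_self
  have hd : ∀ k, ∑ c, ‖C c k‖ ^ 2 ≤ (Cᴴ * C).trace.re := fun k => by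
    have h : (Cᴴ * C).trace.re = ∑ k, ∑ c, ‖C c k‖ ^ 2 := by
      simp [trace, mul_apply, ← Complex.normSq_apply, Complex.normSq_eq_norm_sq]
    rw [h]
    exact Finset.single_le_sum (f := fun k => ∑ c, ‖C c k‖ ^ 2)
      (fun _ _ => Finset.sum_nonneg fun _ _ => sq_nonneg _) (Finset.mem_univ k)
  have h1 : ‖(Cᴴ * C) a b‖ ≤ ∑ c, (‖C c a‖ ^ 2 + ‖C c b‖ ^ 2) / 2 := by
    rw [mul_apply]
    refine (norm_sum_le _ _).trans (Finset.sum_le_sum fun c _ => ?_)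
    rw [norm_mul, conjTranspose_apply, norm_star]
    nlinarith [sq_nonneg (‖C c a‖ - ‖C c b‖)]
  rw [← Finset.sum_div, Finset.sum_add_distrib] at h1
  linarith [hd a, hd b]

lemma isClosed_posSemidef : IsClosed {A : Matrix n n ℂ | A.PosSemidef} := by
  simp only [posSemidef_iff_dotProduct_mulVec, Set.ofPred_and]
  refine IsClosed.inter (isClosed_eq (by fun_prop) (by fun_prop)) ?_
  simp only [Set.ofPred_forall]
  exact isClosed_iInter fun x => isClosed_le (by fun_prop) (by fun_prop)

lemma convex_posSemidef {m : Type*} : Convex ℝ {A : Matrix m m ℂ | A.PosSemidef} := by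
  intro A hA B hB a b ha hb _
  exact (hA.smul ha).add (hB.smul hb)

/-- The matrices whose real quadratic form is negative definite form an open set. No symmetry is
imposed, so this set is open among all complex matrices, unlike that of negative definite
Hermitian ones. -/
lemma isOpen_re_quadForm_neg :
    IsOpen {A : n → n → ℂ | ∀ x : n → ℂ, x ≠ 0 → (star x ⬝ᵥ (of A *ᵥ x)).re < 0} := by
  have hset : {A : n → n → ℂ | ∀ x : n → ℂ, x ≠ 0 → (star x ⬝ᵥ (of A *ᵥ x)).re < 0} =
      {A | ∀ x ∈ Metric.sphere (0 : n → ℂ) 1, (star x ⬝ᵥ (of A *ᵥ x)).re < 0} := by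
    ext A
    refine ⟨fun h x hx => h x ?_, fun h x hx => ?_⟩
    · rintro rfl
      simp at hx
    · have hx' : 0 < ‖x‖ := norm_pos_iff.mpr hx
      have h1 := h (((‖x‖⁻¹ : ℝ) : ℂ) • x) (by simp [norm_smul, hx'.ne'])
      rw [mulVec_smul, star_smul, smul_dotProduct, dotProduct_smul] at h1
      simp only [smul_eq_mul, Complex.star_def, Complex.conj_ofReal, Complex.re_ofReal_mul] at h1
      have := inv_pos.mpr hx'
      by_contra hc
      push Not at hc
      have : 0 ≤ ‖x‖⁻¹ * (‖x‖⁻¹ * (star x ⬝ᵥ of A *ᵥ x).re) := by positivity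
      linarith
  rw [hset, isOpen_iff_eventually]
  intro A hA
  refine (isCompact_sphere (0 : n → ℂ) 1).eventually_forall_of_forall_eventually fun x hx => ?_
  have hc : Continuous fun z : (n → n → ℂ) × (n → ℂ) =>
      (star z.2 ⬝ᵥ (of z.1 *ᵥ z.2)).re := by
    have : Continuous fun z : (n → n → ℂ) × (n → ℂ) => (of z.1 : Matrix n n ℂ) := continuous_fst
    fun_prop
  exact hc.continuousAt.eventually_lt continuousAt_const (hA x hx)

/-- Riesz representation on the real space of Hermitian matrices, for the trace form. -/
lemma exists_isHermitian_trace_re_eq (g : (n → n → ℂ) →ₗ[ℝ] ℝ) :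
    ∃ V : Matrix n n ℂ, V.IsHermitian ∧
      ∀ Y : Matrix n n ℂ, Y.IsHermitian → g (fun a b => Y a b) = (V * Y).trace.re := by
  classical
  let e : n → n → ℂ → n → n → ℂ := fun a b z => Pi.single a (Pi.single b z)
  let U : Matrix n n ℂ := of fun b a => (g (e a b 1) : ℂ) - Complex.I * g (e a b Complex.I)
  have hU : ∀ Y : Matrix n n ℂ, g (fun a b => Y a b) = (U * Y).trace.re := by
    intro Y
    have h1 : (fun a b => Y a b) =
        ∑ b, ∑ a, ((Y a b).re • e a b 1 + (Y a b).im • e a b Complex.I) := by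
      have h2 : ∀ a b, (Y a b).re • e a b 1 + (Y a b).im • e a b Complex.I = e a b (Y a b) := by
        intro a b
        simp only [e, ← Pi.single_smul, ← Pi.single_add]
        congr 2
        simp [Complex.re_add_im]
      simp only [h2]
      ext a b
      simp [e, Finset.sum_apply, Pi.single_apply, Finset.sum_ite_eq]
    rw [h1]
    simp only [map_sum, map_add, map_smul, trace, diag, mul_apply, Complex.re_sum]
    refine Finset.sum_congr rfl fun b _ => Finset.sum_congr rfl fun a _ => ?_
    simp [U]
    ring
  refine ⟨(1 / 2 : ℝ) • (U + Uᴴ), ?_, fun Y hY => ?_⟩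
  · simp [IsHermitian, conjTranspose_smul, add_comm]
  · have h : (Uᴴ * Y).trace.re = (U * Y).trace.re := by
      rw [← hY.eq, ← conjTranspose_mul, trace_conjTranspose, hY.eq, trace_mul_comm]
      simp
    rw [hU, Matrix.smul_mul, trace_smul, add_mul, trace_add, Complex.smul_re, Complex.add_re, h]
    simp
    ring

end Matrix

/-! ### Lagrange duality for semidefinite constraints -/

namespace Matrix

variable {n : Type*} [Fintype n]

/-- **Semidefinite Lagrange duality** under Slater's condition: the convex program of minimizing
`φ x` over `x ∈ S` with `G x i ⪰ 0` for all `i` has multipliers `V i ⪰ 0` for which the Lagrangian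
`φ x - ∑ i, tr (V i * G x i)` is at least any lower bound `p` of the program. -/
theorem exists_posSemidef_multipliers {ι E : Type*} [Fintype ι] [AddCommGroup E] [Module ℝ E]
    {S : Set E} (hS : Convex ℝ S) (φ : E →ₗ[ℝ] ℝ) (G : E → ι → Matrix n n ℂ)
    (hG : ∀ x ∈ S, ∀ y ∈ S, ∀ a b : ℝ, a + b = 1 → G (a • x + b • y) = a • G x + b • G y)
    (hH : ∀ x ∈ S, ∀ i, (G x i).IsHermitian) {p : ℝ}
    (hp : ∀ x ∈ S, (∀ i, (G x i).PosSemidef) → p ≤ φ x)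
    {x₀ : E} (hx₀ : x₀ ∈ S) (hslater : ∀ i, (G x₀ i).PosDef) :
    ∃ V : ι → Matrix n n ℂ, (∀ i, (V i).PosSemidef) ∧
      ∀ x ∈ S, p + ∑ i, (V i * G x i).trace.re ≤ φ x := by
  classical
  let Neg : Set (n → n → ℂ) := {A | ∀ x : n → ℂ, x ≠ 0 → (star x ⬝ᵥ (of A *ᵥ x)).re < 0}
  have hNegConvex : Convex ℝ Neg := by
    intro A hA B hB a b ha hb hab x hx
    have h : (star x ⬝ᵥ (of (a • A + b • B) *ᵥ x)).re =
        a * (star x ⬝ᵥ (of A *ᵥ x)).re + b * (star x ⬝ᵥ (of B *ᵥ x)).re := by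
      rw [show of (a • A + b • B) = a • of A + b • of B from rfl, add_mulVec, smul_mulVec, smul_mulVec,
        dotProduct_add, dotProduct_smul, dotProduct_smul]
      simp
    rw [h]
    rcases ha.eq_or_lt with rfl | ha
    · obtain rfl : b = 1 := by linarith
      linarith [hB x hx]
    · nlinarith [mul_neg_of_pos_of_neg ha (hA x hx), hB x hx]
  have hNegOf : ∀ {A : Matrix n n ℂ}, A.PosDef → (fun a b => -A a b) ∈ Neg := by
    intro A hA x hx
    have h := (Complex.lt_def.mp (hA.dotProduct_mulVec_pos hx)).1
    change (star x ⬝ᵥ ((-A) *ᵥ x)).re < 0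
    rw [neg_mulVec, dotProduct_neg, Complex.neg_re]
    simpa using h
  let A : Set (ℝ × (ι → n → n → ℂ)) := Set.Iio p ×ˢ Set.univ.pi fun _ => Neg
  let B : Set (ℝ × (ι → n → n → ℂ)) := (fun x => (φ x, fun i a b => -G x i a b)) '' S
  have hA : Convex ℝ A := (convex_Iio p).prod (convex_pi fun _ _ => hNegConvex)
  have hAo : IsOpen A :=
    isOpen_Iio.prod (isOpen_set_pi Set.finite_univ fun _ _ => isOpen_re_quadForm_neg)
  have hB : Convex ℝ B := by
    rintro _ ⟨x, hx, rfl⟩ _ ⟨y, hy, rfl⟩ a b ha hb hab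
    refine ⟨a • x + b • y, hS hx hy ha hb hab, Prod.ext (by simp) ?_⟩
    ext i c d
    simp only [hG x hx y hy a b hab]
    simp
    ring
  have hdisj : Disjoint A B := by
    rw [Set.disjoint_left]
    rintro _ ⟨h1, h2⟩ ⟨x, hx, rfl⟩
    refine absurd (hp x hx fun i => ?_) (not_le.mpr h1)
    refine PosSemidef.of_dotProduct_mulVec_nonneg (hH x hx i) fun z => ?_
    rcases eq_or_ne z 0 with rfl | hz
    · simp
    have h3 : (star z ⬝ᵥ ((-G x i) *ᵥ z)).re < 0 := h2 i trivial z hz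
    rw [neg_mulVec, dotProduct_neg, Complex.neg_re] at h3
    refine Complex.le_def.mpr ⟨by simpa using h3.le, ?_⟩
    exact ((hH x hx i).im_star_dotProduct_mulVec_self z).symm
  obtain ⟨f, u, hfA, hfB⟩ := geometric_hahn_banach_open hA hAo hB hdisj
  let α : ℝ := f (1, 0)
  let g : ι → (n → n → ℂ) →ₗ[ℝ] ℝ := fun i =>
    f.toLinearMap ∘ₗ LinearMap.inr ℝ ℝ _ ∘ₗ LinearMap.single ℝ (fun _ => n → n → ℂ) i
  have hf : ∀ s Y, f (s, Y) = s * α + ∑ i, g i (Y i) := by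
    intro s Y
    have h : ((s, Y) : ℝ × (ι → n → n → ℂ)) = s • (1, 0) + LinearMap.inr ℝ ℝ _ Y := by simp
    have h2 : Y = ∑ i, LinearMap.single ℝ (fun _ => n → n → ℂ) i (Y i) := by
      simp [Finset.univ_sum_single]
    rw [h, map_add, map_smul, smul_eq_mul]
    congr 1
    conv_lhs => rw [h2]
    simp only [map_sum]
    rfl
  choose V₀ hV₀ hgV using fun i => exists_isHermitian_trace_re_eq (g i)
  -- the values of the separating functional on Hermitian arguments
  have hfV : ∀ s (Y : ι → Matrix n n ℂ), (∀ i, (Y i).IsHermitian) →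
      f (s, fun i a b => -Y i a b) = s * α - ∑ i, (V₀ i * Y i).trace.re := by
    intro s Y hY
    rw [hf, sub_eq_add_neg, ← Finset.sum_neg_distrib]
    congr 1
    refine Finset.sum_congr rfl fun i _ => ?_
    rw [← hgV i (Y i) (hY i), ← map_neg]
    rfl
  have hmemA : ∀ s < p, ∀ Y : ι → Matrix n n ℂ, (∀ i, (Y i).PosDef) →
      s * α - ∑ i, (V₀ i * Y i).trace.re < u := by
    intro s hs Y hY
    rw [← hfV s Y fun i => (hY i).isHermitian]
    exact hfA _ ⟨hs, fun i _ => hNegOf (hY i)⟩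
  have hmemB : ∀ x ∈ S, u ≤ φ x * α - ∑ i, (V₀ i * G x i).trace.re := by
    intro x hx
    rw [← hfV _ _ (hH x hx)]
    exact hfB _ ⟨x, hx, rfl⟩
  -- Slater's point excludes a separating hyperplane that is vertical or points the wrong way.
  have hα : 0 < α := by
    have h1 := hmemB x₀ hx₀
    have h2 := hmemA (min (p - 1) (φ x₀ - 1)) ((min_le_left _ _).trans_lt (by linarith)) _ hslater
    have h3 : min (p - 1) (φ x₀ - 1) < φ x₀ := (min_le_right _ _).trans_lt (by linarith)
    nlinarith
  have hV₀pos : ∀ i, (V₀ i).PosSemidef := by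
    intro i
    refine PosSemidef.of_dotProduct_mulVec_nonneg (hV₀ i) fun z => ?_
    refine Complex.le_def.mpr ⟨?_, ((hV₀ i).im_star_dotProduct_mulVec_self z).symm⟩
    rw [Complex.zero_re]
    by_contra! hneg
    set q := (star z ⬝ᵥ V₀ i *ᵥ z).re with hq
    have hray : ∀ t : ℝ, 0 ≤ t →
        (p - 1) * α - ∑ j, (V₀ j).trace.re - t * q < u := by
      intro t ht
      have h := hmemA (p - 1) (by linarith)
        (fun j => 1 + if j = i then t • vecMulVec z (star z) else 0) fun j => by
          refine PosDef.one.add_posSemidef ?_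
          split_ifs
          · exact (posSemidef_vecMulVec_self_star z).smul ht
          · exact PosSemidef.zero
      have hs : ∑ j, (V₀ j * (1 + if j = i then t • vecMulVec z (star z) else 0)).trace.re =
          ∑ j, (V₀ j).trace.re + t * q := by
        have hj : ∀ j, (V₀ j * (1 + if j = i then t • vecMulVec z (star z) else 0)).trace.re =
            (V₀ j).trace.re + if j = i then t * q else 0 := by
          intro j
          split_ifs with hji
          · subst hji
            rw [mul_add, mul_one, trace_add, Matrix.mul_smul, trace_smul, mul_vecMulVec,
              trace_vecMulVec, dotProduct_comm, Complex.add_re, Complex.smul_re, smul_eq_mul]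
          · simp
        simp [hj, Finset.sum_add_distrib]
      rw [hs] at h
      linarith
    have h0 := hray 0 le_rfl
    have h1 := hray ((u - ((p - 1) * α - ∑ j, (V₀ j).trace.re)) / (-q))
      (div_nonneg (by linarith) (by linarith))
    have h2 : (u - ((p - 1) * α - ∑ j, (V₀ j).trace.re)) / (-q) * q =
        -(u - ((p - 1) * α - ∑ j, (V₀ j).trace.re)) := by
      have hq0 : q ≠ 0 := hneg.ne
      field_simp
    linarith
  -- `(p, 0)` lies in the closure of the open set
  have hpu : p * α ≤ u := by
    have hlim : Filter.Tendsto (fun ε : ℝ => (p - ε) * α - ∑ i, ε * (V₀ i).trace.re)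
        (nhdsWithin 0 (Set.Ioi 0)) (nhds ((p - 0) * α - ∑ i, 0 * (V₀ i).trace.re)) :=
      (Continuous.tendsto (by fun_prop) 0).mono_left nhdsWithin_le_nhds
    have hle := le_of_tendsto hlim (b := u) <| by
      filter_upwards [self_mem_nhdsWithin] with ε hε
      have hε : 0 < ε := hε
      have h := hmemA (p - ε) (by linarith) (fun _ => ε • 1) fun _ => PosDef.one.smul hε
      simpa using h.le
    simpa using hle
  refine ⟨fun i => α⁻¹ • V₀ i, fun i => (hV₀pos i).smul (inv_pos.mpr hα).le, fun x hx => ?_⟩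
  have h := hpu.trans (hmemB x hx)
  simp only [Matrix.smul_mul, trace_smul, Complex.smul_re, smul_eq_mul, ← Finset.mul_sum]
  rw [← mul_le_mul_iff_of_pos_right hα, add_mul, mul_right_comm, inv_mul_cancel₀ hα.ne', one_mul]
  linarith

end Matrix

/-! ### Linearity and Hermitian symmetry of the constraints -/

namespace Downlink

variable {K N : ℕ}

lemma power_add (W W' : Fin K → Matrix (Fin N) (Fin N) ℂ) :
    power (W + W') = power W + power W' := by
  simp [power, Finset.sum_add_distrib]

lemma power_smul (t : ℝ) (W : Fin K → Matrix (Fin N) (Fin N) ℂ) :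
    power (t • W) = t * power W := by
  simp [power, Finset.mul_sum]

lemma gap_add (D : Downlink K N) (W W' : Fin K → Matrix (Fin N) (Fin N) ℂ) (i : Fin K) :
    D.gap (W + W') i = D.gap W i + D.gap W' i := by
  simp only [gap, Pi.add_apply, smul_add, Finset.sum_add_distrib]
  abel

lemma gap_smul (D : Downlink K N) (t : ℝ) (W : Fin K → Matrix (Fin N) (Fin N) ℂ) (i : Fin K) :
    D.gap (t • W) i = t • D.gap W i := by
  simp only [gap, Pi.smul_apply, smul_sub, Finset.smul_sum]
  rw [smul_comm]

lemma isHermitian_gap (D : Downlink K N) {W : Fin K → Matrix (Fin N) (Fin N) ℂ}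
    (hW : ∀ i, (W i).IsHermitian) (i : Fin K) : (D.gap W i).IsHermitian := by
  simp only [Matrix.IsHermitian, gap, Matrix.conjTranspose_sub, Matrix.conjTranspose_smul,
    Matrix.conjTranspose_sum, (hW _).eq, Complex.star_def, Complex.conj_ofReal]

/-- The slack block of `Psi` is diagonal. -/
lemma fromBlocks_smul_one_eq_diagonal (a b : ℝ) :
    Matrix.fromBlocks ((a : ℂ) • (1 : Matrix (Fin N) (Fin N) ℂ)) 0 0
      ((b : ℂ) • (1 : Matrix Unit Unit ℂ)) =
      Matrix.diagonal (Sum.elim (fun _ => (a : ℂ)) fun _ => (b : ℂ)) := by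
  rw [Matrix.smul_one_eq_diagonal, Matrix.smul_one_eq_diagonal, Matrix.fromBlocks_diagonal]

lemma Psi_eq (D : Downlink K N) (W : Fin K → Matrix (Fin N) (Fin N) ℂ) (l : ℝ) (i : Fin K) :
    D.Psi W l i = (D.aug i)ᴴ * D.gap W i * D.aug i +
      Matrix.diagonal (Sum.elim (fun _ => (l : ℂ))
        fun _ => ((-(D.σ i) ^ 2 - l * (D.r i) ^ 2 : ℝ) : ℂ)) := by
  rw [Psi, fromBlocks_smul_one_eq_diagonal]

lemma isHermitian_Psi (D : Downlink K N) {W : Fin K → Matrix (Fin N) (Fin N) ℂ}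
    (hW : ∀ i, (W i).IsHermitian) (l : ℝ) (i : Fin K) : (D.Psi W l i).IsHermitian := by
  rw [Psi_eq]
  refine (Matrix.isHermitian_conjTranspose_mul_mul _ (D.isHermitian_gap hW i)).add
    (Matrix.isHermitian_diagonal_of_self_adjoint _ ?_)
  ext (_ | _) <;> simp

lemma Psi_affine (D : Downlink K N) (W W' : Fin K → Matrix (Fin N) (Fin N) ℂ) (l l' a b : ℝ)
    (hab : a + b = 1) (i : Fin K) :
    D.Psi (a • W + b • W') (a * l + b * l') i = a • D.Psi W l i + b • D.Psi W' l' i := by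
  simp only [Psi_eq, gap_add, gap_smul, Matrix.mul_add, Matrix.add_mul, Matrix.mul_smul,
    Matrix.smul_mul, smul_add]
  have h : Matrix.diagonal (Sum.elim (fun _ : Fin N => ((a * l + b * l' : ℝ) : ℂ))
        fun _ : Unit => ((-(D.σ i) ^ 2 - (a * l + b * l') * (D.r i) ^ 2 : ℝ) : ℂ)) =
      a • Matrix.diagonal (Sum.elim (fun _ : Fin N => (l : ℂ))
        fun _ : Unit => ((-(D.σ i) ^ 2 - l * (D.r i) ^ 2 : ℝ) : ℂ)) +
      b • Matrix.diagonal (Sum.elim (fun _ : Fin N => (l' : ℂ))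
        fun _ : Unit => ((-(D.σ i) ^ 2 - l' * (D.r i) ^ 2 : ℝ) : ℂ)) := by
    rw [← Matrix.diagonal_smul, ← Matrix.diagonal_smul, Matrix.diagonal_add]
    congr 1
    ext (j | j)
    · simp
    · obtain rfl : b = 1 - a := by linarith
      simp
      ring
  rw [h]
  abel

/-- Doubling a feasible point and raising `l` by a small `δ` makes `Psi` positive definite: doubling
leaves `σ ^ 2` of slack in the corner, of which the raise spends `δ * r ^ 2`. -/
lemma posDef_Psi_two_smul (D : Downlink K N) {W : Fin K → Matrix (Fin N) (Fin N) ℂ} {l δ : ℝ}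
    {i : Fin K} (h : (D.Psi W l i).PosSemidef) (hδ : 0 < δ)
    (hδσ : δ * (D.r i) ^ 2 < (D.σ i) ^ 2) : (D.Psi ((2 : ℝ) • W) (2 * l + δ) i).PosDef := by
  have h1 : D.Psi ((2 : ℝ) • W) (2 * l + δ) i = (2 : ℝ) • D.Psi W l i +
      Matrix.diagonal (Sum.elim (fun _ : Fin N => (δ : ℂ))
        fun _ : Unit => (((D.σ i) ^ 2 - δ * (D.r i) ^ 2 : ℝ) : ℂ)) := by
    simp only [Psi_eq, gap_smul, Matrix.mul_smul, Matrix.smul_mul, smul_add, add_assoc]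
    rw [← Matrix.diagonal_smul, Matrix.diagonal_add]
    congr 2
    ext (j | j)
    · simp
    · simp
      ring
  rw [h1]
  refine Matrix.PosDef.posSemidef_add (h.smul (by norm_num)) (Matrix.PosDef.diagonal ?_)
  rintro (_ | _)
  · simpa using hδ
  · simp only [Sum.elim_inr]
    exact_mod_cast sub_pos.mpr hδσ

/-! ### The Lagrangian and weak duality -/

/-- The pairing of a multiplier `V` with `Psi`. Its `l`-coefficient yields the trace bound of the
outer problem, its constant term the noise power. -/
lemma trace_mul_Psi_re (D : Downlink K N)
    (V : Fin K → Matrix (Fin N ⊕ Unit) (Fin N ⊕ Unit) ℂ) (W : Fin K → Matrix (Fin N) (Fin N) ℂ)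
    (l : ℝ) (i : Fin K) :
    (V i * D.Psi W l i).trace.re = (D.gap W i * D.R V i).trace.re +
      l * ((V i).trace.re - (1 + (D.r i) ^ 2) * (V i (Sum.inr ()) (Sum.inr ())).re) -
      (D.σ i) ^ 2 * (V i (Sum.inr ()) (Sum.inr ())).re := by
  have h1 : (V i * ((D.aug i)ᴴ * D.gap W i * D.aug i)).trace = (D.gap W i * D.R V i).trace := by
    rw [R, ← Matrix.mul_assoc, Matrix.trace_mul_comm, ← Matrix.mul_assoc, ← Matrix.mul_assoc,
      Matrix.trace_mul_comm]
  rw [Psi_eq, Matrix.mul_add, Matrix.trace_add, h1, Complex.add_re, add_sub_assoc]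
  congr 1
  simp only [Matrix.trace, Matrix.diag, Matrix.mul_diagonal, Fintype.sum_sum_type, Sum.elim_inl,
    Sum.elim_inr, Finset.univ_unique, Finset.sum_singleton, Complex.add_re, Complex.re_sum,
    Complex.re_mul_ofReal, ← Finset.sum_mul, PUnit.default_eq_unit]
  ring

/-- The cone `W ⪰ 0`, `lam ≥ 0` in which the robust program is posed. -/
def robustCone (K N : ℕ) : Set ((Fin K → Matrix (Fin N) (Fin N) ℂ) × (Fin K → ℝ)) :=
  {x | (∀ i, (x.1 i).PosSemidef) ∧ ∀ i, 0 ≤ x.2 i}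

lemma convex_robustCone : Convex ℝ (robustCone K N) := fun _ hx _ hy _ _ ha hb hab =>
  ⟨fun i => Matrix.convex_posSemidef (hx.1 i) (hy.1 i) ha hb hab,
    fun i => add_nonneg (mul_nonneg ha (hx.2 i)) (mul_nonneg hb (hy.2 i))⟩

/-- Weak duality: the first component of a robust feasible point is feasible for every inner
problem. -/
lemma mem_innerFeasible_of_robustFeasible (D : Downlink K N)
    {V : Fin K → Matrix (Fin N ⊕ Unit) (Fin N ⊕ Unit) ℂ} (hV : V ∈ D.outerFeasible)
    {x : (Fin K → Matrix (Fin N) (Fin N) ℂ) × (Fin K → ℝ)} (hx : x ∈ D.robustFeasible) :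
    x.1 ∈ D.innerFeasible V := by
  refine ⟨fun i => ?_, hx.2.1⟩
  have h := (hV.2.2 i).trace_mul_re_nonneg (hx.1 i)
  rw [trace_mul_Psi_re, hV.2.1 i, Complex.one_re] at h
  nlinarith [mul_nonneg (hx.2.2 i) (sub_nonneg.mpr (hV.1 i))]

lemma innerValue_le_power (D : Downlink K N)
    {V : Fin K → Matrix (Fin N ⊕ Unit) (Fin N ⊕ Unit) ℂ} (hV : V ∈ D.outerFeasible)
    {x : (Fin K → Matrix (Fin N) (Fin N) ℂ) × (Fin K → ℝ)} (hx : x ∈ D.robustFeasible) :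
    D.innerValue V ≤ power x.1 :=
  iInf₂_le x.1 (D.mem_innerFeasible_of_robustFeasible hV hx)

lemma le_innerValue (D : Downlink K N) {V : Fin K → Matrix (Fin N ⊕ Unit) (Fin N ⊕ Unit) ℂ}
    {p : ℝ} (h : ∀ W ∈ D.innerFeasible V, p ≤ power W) : (p : EReal) ≤ D.innerValue V :=
  le_iInf₂ fun W hW => EReal.coe_le_coe_iff.mpr (h W hW)

/-! ### Attainment of the robust minimum -/

/-- The corner entry `h̄ᴴ (gap W) h̄ - σ ^ 2 - l * r ^ 2` of `Psi` is nonnegative. -/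
lemma corner_bound (D : Downlink K N) {W : Fin K → Matrix (Fin N) (Fin N) ℂ} {l : ℝ} {i : Fin K}
    (h : (D.Psi W l i).PosSemidef) :
    (D.σ i) ^ 2 + l * (D.r i) ^ 2 ≤
      (((D.aug i)ᴴ * D.gap W i * D.aug i) (Sum.inr ()) (Sum.inr ())).re := by
  have h1 := (Complex.le_def.mp (h.diag_nonneg (i := Sum.inr ()))).1
  rw [Psi_eq, Matrix.add_apply, Matrix.diagonal_apply_eq, Complex.add_re, Sum.elim_inr,
    Complex.ofReal_re, Complex.zero_re] at h1
  linarith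

lemma continuous_gap (D : Downlink K N) (i : Fin K) :
    Continuous fun W : Fin K → Matrix (Fin N) (Fin N) ℂ => D.gap W i := by
  unfold gap
  fun_prop

lemma continuous_Psi (D : Downlink K N) (i : Fin K) :
    Continuous fun x : (Fin K → Matrix (Fin N) (Fin N) ℂ) × (Fin K → ℝ) =>
      D.Psi x.1 (x.2 i) i := by
  have := (D.continuous_gap i).comp (continuous_fst (Y := Fin K → ℝ))
  unfold Psi
  refine Continuous.add ?_ (Continuous.matrix_fromBlocks ?_ continuous_const continuous_const ?_)
  · exact (continuous_const.matrix_mul this).matrix_mul continuous_const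
  all_goals fun_prop

lemma continuous_power :
    Continuous (power : (Fin K → Matrix (Fin N) (Fin N) ℂ) → ℝ) := by
  unfold power
  fun_prop

lemma isClosed_robustFeasible (D : Downlink K N) : IsClosed D.robustFeasible := by
  simp only [robustFeasible, Set.ofPred_and, Set.ofPred_forall]
  refine IsClosed.inter (isClosed_iInter fun i => ?_) (IsClosed.inter (isClosed_iInter fun i => ?_)
    (isClosed_iInter fun i => ?_))
  · exact Matrix.isClosed_posSemidef.preimage (D.continuous_Psi i)
  · exact Matrix.isClosed_posSemidef.preimage (by fun_prop)
  · exact isClosed_le continuous_const (by fun_prop)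

/-- The robust problem attains its minimum. Its sublevel sets are compact: the trace bounds `W`, and
the corner entry of `Psi` then bounds `lam`, because the radii are positive. -/
lemma exists_isRobustOptimal (D : Downlink K N) (hr : ∀ i, 0 < D.r i)
    (hfeas : D.robustFeasible.Nonempty) : ∃ W lam, D.IsRobustOptimal W lam := by
  obtain ⟨x₀, hx₀⟩ := hfeas
  let T : Set ((Fin K → Matrix (Fin N) (Fin N) ℂ) × (Fin K → ℝ)) :=
    D.robustFeasible ∩ {x | power x.1 ≤ power x₀.1}
  have hTc : IsClosed T := D.isClosed_robustFeasible.inter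
    (isClosed_le (continuous_power.comp continuous_fst) continuous_const)
  let Q : Set (Fin K → Matrix (Fin N) (Fin N) ℂ) :=
    Set.univ.pi fun _ => Set.univ.pi fun _ => Set.univ.pi fun _ =>
      Metric.closedBall 0 (power x₀.1)
  have hQ : IsCompact Q := isCompact_univ_pi fun _ => isCompact_univ_pi fun _ =>
    isCompact_univ_pi fun _ => isCompact_closedBall _ _
  have hcorner : ∀ i, ∃ c : ℝ, ∀ W ∈ Q,
      (((D.aug i)ᴴ * D.gap W i * D.aug i) (Sum.inr ()) (Sum.inr ())).re ≤ c := by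
    intro i
    have hc : Continuous fun W : Fin K → Matrix (Fin N) (Fin N) ℂ =>
        (((D.aug i)ᴴ * D.gap W i * D.aug i) (Sum.inr ()) (Sum.inr ())).re :=
      Complex.continuous_re.comp (Continuous.matrix_elem
        ((continuous_const.matrix_mul (D.continuous_gap i)).matrix_mul continuous_const) _ _)
    obtain ⟨c, hc⟩ := hQ.bddAbove_image hc.continuousOn
    exact ⟨c, fun W hW => hc ⟨W, hW, rfl⟩⟩
  choose c hc using hcorner
  have hTcompact : IsCompact T := by
    refine (hQ.prod (isCompact_univ_pi fun i =>
      isCompact_Icc (a := (0 : ℝ)) (b := c i / (D.r i) ^ 2))).of_isClosed_subset hTc ?_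
    rintro ⟨W, lam⟩ ⟨⟨hPsi, hW, hlam⟩, hpow⟩
    have hWQ : W ∈ Q := by
      intro k _ a _ b _
      rw [mem_closedBall_zero_iff]
      refine ((hW k).norm_apply_le_trace a b).trans (le_trans ?_ hpow)
      exact Finset.single_le_sum (f := fun k => (W k).trace.re)
        (fun k _ => (Complex.le_def.mp (hW k).trace_nonneg).1) (Finset.mem_univ k)
    refine ⟨hWQ, fun i _ => ⟨hlam i, ?_⟩⟩
    rw [le_div_iff₀ (pow_pos (hr i) 2)]
    have h1 := D.corner_bound (hPsi i)
    have h2 := hc i W hWQ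
    have h3 := sq_nonneg (D.σ i)
    dsimp only at h1 h2 ⊢
    linarith
  obtain ⟨x, hxT, hx⟩ := hTcompact.exists_isMinOn ⟨x₀, hx₀, le_refl (power x₀.1)⟩
    (continuous_power.comp continuous_fst).continuousOn
  refine ⟨x.1, x.2, hxT.1, fun y hy => ?_⟩
  rcases le_total (power y.1) (power x₀.1) with h | h
  · exact hx ⟨hy, h⟩
  · exact le_trans hxT.2 h

/-! ### Strong duality -/

/-- Normalizing a multiplier: a positive semidefinite `U` with corner entry `v` and trace at most
`(1 + ρ ^ 2) * v` is `v` times a matrix satisfying the constraints of the outer problem. If `v = 0`,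
then `U = 0` and any such matrix will do. -/
lemma exists_normalized {U : Matrix (Fin N ⊕ Unit) (Fin N ⊕ Unit) ℂ} (hU : U.PosSemidef) {ρ : ℝ}
    (htr : U.trace.re ≤ (1 + ρ ^ 2) * (U (Sum.inr ()) (Sum.inr ())).re) :
    ∃ V : Matrix (Fin N ⊕ Unit) (Fin N ⊕ Unit) ℂ, V.PosSemidef ∧ V.trace.re ≤ 1 + ρ ^ 2 ∧
      V (Sum.inr ()) (Sum.inr ()) = 1 ∧ U = (U (Sum.inr ()) (Sum.inr ())).re • V := by
  have hcorner := Complex.le_def.mp (hU.diag_nonneg (i := Sum.inr ()))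
  set v := (U (Sum.inr ()) (Sum.inr ())).re with hv
  have hUv : U (Sum.inr ()) (Sum.inr ()) = (v : ℂ) := Complex.ext rfl hcorner.2.symm
  have hv0 : 0 ≤ v := hcorner.1
  rcases hv0.eq_or_lt with h0 | hpos
  · refine ⟨Matrix.diagonal (Sum.elim 0 1), Matrix.PosSemidef.diagonal ?_, ?_, by simp, ?_⟩
    · rintro (_ | _) <;> simp
    · simp [Matrix.trace, sq_nonneg]
    · rw [← h0, zero_smul, ← hU.trace_eq_zero_iff]
      have ht := Complex.le_def.mp hU.trace_nonneg
      rw [← h0, mul_zero] at htr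
      exact Complex.ext (le_antisymm htr ht.1) ht.2.symm
  · refine ⟨v⁻¹ • U, hU.smul (inv_pos.mpr hpos).le, ?_, ?_, ?_⟩
    · rw [Matrix.trace_smul, Complex.smul_re, smul_eq_mul, inv_mul_le_iff₀ hpos]
      linarith
    · rw [Matrix.smul_apply, hUv, Complex.real_smul, ← Complex.ofReal_mul,
        inv_mul_cancel₀ hpos.ne', Complex.ofReal_one]
    · rw [smul_inv_smul₀ hpos.ne']

/-- Strong duality: some feasible `V` for the outer problem forces every inner feasible `W` to spend
at least the optimal power of the robust problem. -/
theorem exists_outerFeasible_le_power (D : Downlink K N) (hσ : ∀ i, 0 < (D.σ i) ^ 2)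
    (hr : ∀ i, 0 < D.r i) (hfeas : D.robustFeasible.Nonempty) {p : ℝ}
    (hp : ∀ x ∈ D.robustFeasible, p ≤ power x.1) :
    ∃ V ∈ D.outerFeasible, ∀ W ∈ D.innerFeasible V, p ≤ power W := by
  obtain ⟨⟨W₀, lam₀⟩, hx₀⟩ := hfeas
  let φ : (Fin K → Matrix (Fin N) (Fin N) ℂ) × (Fin K → ℝ) →ₗ[ℝ] ℝ :=
    { toFun := fun x => power x.1
      map_add' := fun x y => power_add x.1 y.1
      map_smul' := fun t x => power_smul t x.1 }
  have hr2 : ∀ i, 0 < (D.r i) ^ 2 := fun i => pow_pos (hr i) 2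
  let δ : Fin K → ℝ := fun i => (D.σ i) ^ 2 / (2 * (D.r i) ^ 2)
  have hδ : ∀ i, 0 < δ i := fun i => div_pos (hσ i) (mul_pos two_pos (hr2 i))
  obtain ⟨U, hU, hdual⟩ := Matrix.exists_posSemidef_multipliers convex_robustCone φ
    (fun x i => D.Psi x.1 (x.2 i) i)
    (fun x _ y _ a b hab => funext fun i => D.Psi_affine x.1 y.1 (x.2 i) (y.2 i) a b hab i)
    (fun x hx i => D.isHermitian_Psi (fun j => (hx.1 j).isHermitian) _ i)
    (fun x hx h => hp x ⟨h, hx.1, hx.2⟩)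
    (x₀ := ((2 : ℝ) • W₀, fun i => 2 * lam₀ i + δ i))
    ⟨fun i => (hx₀.2.1 i).smul (zero_le_two (α := ℝ)),
      fun i => add_nonneg (mul_nonneg zero_le_two (hx₀.2.2 i)) (hδ i).le⟩
    (fun i => D.posDef_Psi_two_smul (hx₀.1 i) (hδ i) (by
      have h : δ i * (D.r i) ^ 2 = (D.σ i) ^ 2 / 2 := by
        have := (hr i).ne'
        simp only [δ]
        field_simp
      rw [h]
      linarith [hσ i]))
  let v : Fin K → ℝ := fun i => (U i (Sum.inr ()) (Sum.inr ())).re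
  have hv : ∀ i, 0 ≤ v i := fun i => (Complex.le_def.mp ((hU i).diag_nonneg (i := Sum.inr ()))).1
  have hLag : ∀ W : Fin K → Matrix (Fin N) (Fin N) ℂ, (∀ i, (W i).PosSemidef) →
      ∀ lam : Fin K → ℝ, (∀ i, 0 ≤ lam i) →
      p + (∑ i, (D.gap W i * D.R U i).trace.re +
        ∑ i, lam i * ((U i).trace.re - (1 + (D.r i) ^ 2) * v i) - ∑ i, (D.σ i) ^ 2 * v i) ≤
        power W := by
    intro W hW lam hlam
    have h := hdual (W, lam) ⟨hW, hlam⟩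
    simp only [trace_mul_Psi_re, Finset.sum_add_distrib, Finset.sum_sub_distrib] at h
    exact h
  have hgap0 : ∀ i, D.gap 0 i = 0 := fun i => by simp [gap]
  -- The Lagrangian is bounded below on a cone, so each of its homogeneous parts is nonnegative.
  have of_ray : ∀ {c d : ℝ}, (∀ t : ℝ, 0 ≤ t → c + t * d ≤ 0) → d ≤ 0 := by
    intro c d h
    by_contra! hd
    have h1 := h ((|c| + 1) / d) (by positivity)
    rw [div_mul_cancel₀ _ hd.ne'] at h1
    linarith [neg_abs_le c]
  have hp0 : p ≤ ∑ i, (D.σ i) ^ 2 * v i := by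
    have h := hLag 0 (fun _ => Matrix.PosSemidef.zero) 0 fun _ => le_rfl
    simp only [hgap0, power, Pi.zero_apply, Matrix.trace_zero, Complex.zero_re, zero_mul,
      Finset.sum_const_zero] at h
    linarith
  have htr : ∀ i, (U i).trace.re ≤ (1 + (D.r i) ^ 2) * v i := by
    intro i
    refine sub_nonpos.mp (of_ray (c := p - ∑ i, (D.σ i) ^ 2 * v i) fun t ht => ?_)
    have h := hLag 0 (fun _ => Matrix.PosSemidef.zero) (Pi.single i t)
      (fun j => (Pi.single_nonneg.mpr ht : (0 : Fin K → ℝ) ≤ Pi.single i t) j)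
    simp only [hgap0, power, Pi.zero_apply, Matrix.trace_zero, Complex.zero_re,
      Finset.sum_const_zero, Pi.single_apply, ite_mul, zero_mul, Finset.sum_ite_eq',
      Finset.mem_univ, if_true] at h
    linarith
  have hpow : ∀ W : Fin K → Matrix (Fin N) (Fin N) ℂ, (∀ i, (W i).PosSemidef) →
      ∑ i, (D.gap W i * D.R U i).trace.re ≤ power W := by
    intro W hW
    refine sub_nonpos.mp (of_ray (c := p - ∑ i, (D.σ i) ^ 2 * v i) fun t ht => ?_)
    have h := hLag (t • W) (fun i => (hW i).smul ht) 0 fun _ => le_rfl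
    simp only [gap_smul, power_smul, Pi.zero_apply, Matrix.smul_mul, Matrix.trace_smul,
      Complex.smul_re, smul_eq_mul, zero_mul, Finset.sum_const_zero, ← Finset.mul_sum] at h
    linarith
  choose V hVpos hVtr hVone hUV using fun i => exists_normalized (hU i) (htr i)
  refine ⟨V, ⟨hVtr, hVone, hVpos⟩, fun W hW => ?_⟩
  have hR : ∀ i, D.R U i = v i • D.R V i := by
    intro i
    rw [R, hUV i, Matrix.mul_smul, Matrix.smul_mul, R]
  calc p ≤ ∑ i, (D.σ i) ^ 2 * v i := hp0
    _ ≤ ∑ i, (D.gap W i * D.R U i).trace.re := by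
      refine Finset.sum_le_sum fun i _ => ?_
      rw [hR, Matrix.mul_smul, Matrix.trace_smul, Complex.smul_re, smul_eq_mul, mul_comm]
      exact mul_le_mul_of_nonneg_left (hW.1 i) (hv i)
    _ ≤ power W := hpow W hW.2

end Downlink

theorem proposition1 (K N : ℕ) (D : Downlink K N)
    (hγ : ∀ i, 0 < D.γ i) (hσ : ∀ i, 0 < (D.σ i) ^ 2) (hr : ∀ i, 0 < D.r i)
    (hfeas : D.robustFeasible.Nonempty) :
    (∃ p : ℝ, IsLeast ((fun x => Downlink.power x.1) '' D.robustFeasible) p ∧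
      IsGreatest (D.innerValue '' D.outerFeasible) (p : EReal)) ∧
    ∀ (W : Fin K → Matrix (Fin N) (Fin N) ℂ) (lam : Fin K → ℝ), D.IsRobustOptimal W lam →
      ∃ V : Fin K → Matrix (Fin N ⊕ Unit) (Fin N ⊕ Unit) ℂ, D.IsOuterInnerOptimal V W := by
  refine ⟨?_, fun W lam hW => ?_⟩
  · obtain ⟨W, lam, hfW, hmin⟩ := D.exists_isRobustOptimal hr hfeas
    obtain ⟨V, hV, hVW⟩ := D.exists_outerFeasible_le_power hσ hr hfeas hmin
    refine ⟨Downlink.power W, ⟨⟨(W, lam), hfW, rfl⟩, ?_⟩, ⟨V, hV, ?_⟩, ?_⟩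
    · rintro _ ⟨x, hx, rfl⟩
      exact hmin x hx
    · exact le_antisymm (D.innerValue_le_power (x := (W, lam)) hV hfW) (D.le_innerValue hVW)
    · rintro _ ⟨V', hV', rfl⟩
      exact D.innerValue_le_power (x := (W, lam)) hV' hfW
  · obtain ⟨hfW, hmin⟩ := hW
    obtain ⟨V, hV, hVW⟩ := D.exists_outerFeasible_le_power hσ hr hfeas hmin
    refine ⟨V, ⟨hV, fun V' hV' => ?_⟩,
      D.mem_innerFeasible_of_robustFeasible (x := (W, lam)) hV hfW, hVW⟩
    exact (D.innerValue_le_power (x := (W, lam)) hV' hfW).trans (D.le_innerValue hVW)
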